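/- Let $\mathfrak H$ be a real separable Hilbert space and let $X=\{X(h):h\in\mathfrak H\}$ be an isonormal Gaussian process over $\mathfrak H$, that is, a centered Gaussian family on a probability space $(\Omega,\mathcal F,P)$ such that $E[X(g)X(h)]=\langle g,h\rangle_{\mathfrak H}$ for all $g,h\in\mathfrak H$. For $q\geq 1$ let $\mathcal H_q$ be the $q$-th Wiener chaos of $X$, i.e. the closed linear subspace of $L^2(\Omega,\mathcal F,P)$ generated by the random variables $H_q(X(h))$ with $h\in\mathfrak H$, $\|h\|_{\mathfrak H}=1$, where $$H_q(x)=(-1)^q e^{x^2/2}\frac{d^q}{dx^q}e^{-x^2/2}$$ is the $q$-th Hermite polynomial. Let $q\geq 2$ and let $Z\in\mathcal H_q$ satisfy $E(Z^2)=1$. Then $3\leq E(Z^4)<\infty$ and, for $N\sim\mathcal N(0,1)$, $$\sup_{z\in\mathbb R}\big|P(Z\leq z)-P(N\leq z)\big|\;\leq\;\sqrt{\frac{q-1}{3q}\,\big(E(Z^4)-3\big)} .$$ -/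

import Mathlib

open MeasureTheory ProbabilityTheory

/-- `X = {X(h) : h ∈ H}` is an isonormal Gaussian process over the real Hilbert space `H`: a centered
Gaussian family on `(Ω, P)` such that `E[X(g) X(h)] = ⟨g, h⟩`. -/
structure IsIsonormalProcess {Ω H : Type*} [MeasurableSpace Ω] [NormedAddCommGroup H]
    [InnerProductSpace ℝ H] (X : H → Ω → ℝ) (P : Measure Ω) : Prop where
  isGaussianProcess : IsGaussianProcess X P
  centered : ∀ h, ∫ ω, X h ω ∂P = 0
  covariance : ∀ g h, ∫ ω, X g ω * X h ω ∂P = inner ℝ g h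

/-- The `q`-th Wiener chaos of `X`: the closed linear subspace of `L²(P)` generated by the random
variables `H_q(X(h))` with `‖h‖ = 1`. Here `H_q` is the `q`-th probabilists' Hermite polynomial
`H_q(x) = (-1)^q e^{x²/2} (d/dx)^q e^{-x²/2}` (see `Polynomial.hermite_eq_deriv_gaussian`). -/
noncomputable def wienerChaos {Ω H : Type*} [MeasurableSpace Ω] [NormedAddCommGroup H]
    (X : H → Ω → ℝ) (P : Measure Ω) (q : ℕ) : Submodule ℝ (Lp ℝ 2 P) :=
  (Submodule.span ℝ {F : Lp ℝ 2 P | ∃ h : H, ‖h‖ = 1 ∧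
    F =ᵐ[P] fun ω => Polynomial.aeval (X h ω) (Polynomial.hermite q)}).topologicalClosure

/-- The Kolmogorov distance `sup_z |μ((-∞, z]) - ν((-∞, z])|` between two probability laws on `ℝ`. -/
noncomputable def kolmogorovDist (μ ν : Measure ℝ) : ℝ :=
  ⨆ z : ℝ, |μ.real (Set.Iic z) - ν.real (Set.Iic z)|

/-! ### Polynomials in Gaussian variables -/

section GaussianPolynomials

open MvPolynomial Finset

variable {σ : Type}

/-- Polynomials of degree at most `d` all of whose monomials have degree of the parity of `d`. -/
noncomputable def parityDegreeLE (σ : Type) (d : ℕ) : Submodule ℝ (MvPolynomial σ ℝ) :=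
  Submodule.span ℝ {p | ∃ m k, m + 2 * k = d ∧ p.IsHomogeneous m}

theorem pderiv_pderiv_swap (i j : σ) (p : MvPolynomial σ ℝ) :
    pderiv i (pderiv j p) = pderiv j (pderiv i p) := by
  by_cases h : i = j
  · rw [h]
  · ext m
    simp only [coeff_pderiv, Finsupp.add_apply, Finsupp.single_eq_of_ne h,
      Finsupp.single_eq_of_ne (Ne.symm h), add_zero]
    rw [add_right_comm]
    ring

theorem isHomogeneous_mem_parityDegreeLE {p : MvPolynomial σ ℝ} {m k : ℕ}
    (hp : p.IsHomogeneous m) : p ∈ parityDegreeLE σ (m + 2 * k) :=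
  Submodule.subset_span ⟨m, k, rfl, hp⟩

theorem mul_mem_parityDegreeLE {p r : MvPolynomial σ ℝ} {a b : ℕ} (hp : p ∈ parityDegreeLE σ a)
    (hr : r ∈ parityDegreeLE σ b) : p * r ∈ parityDegreeLE σ (a + b) := by
  have := Submodule.mul_mem_mul hp hr
  rw [parityDegreeLE, parityDegreeLE, Submodule.span_mul_span] at this
  refine Submodule.span_mono ?_ this
  rintro _ ⟨p, ⟨m, k, rfl, hm⟩, r, ⟨m', k', rfl, hm'⟩, rfl⟩
  exact ⟨m + m', k + k', by ring, hm.mul hm'⟩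

theorem exists_eq_C_of_mem_parityDegreeLE_zero {p : MvPolynomial σ ℝ}
    (hp : p ∈ parityDegreeLE σ 0) : ∃ c, p = C c := by
  induction hp using Submodule.span_induction with
  | mem p hp =>
    obtain ⟨m, k, h, hm⟩ := hp
    obtain rfl : m = 0 := by omega
    exact ⟨_, totalDegree_eq_zero_iff_eq_C.1 ((totalDegree_zero_iff_isHomogeneous σ).2 hm)⟩
  | zero => exact ⟨0, by simp⟩
  | add x y _ _ hx hy =>
    obtain ⟨a, rfl⟩ := hx
    obtain ⟨b, rfl⟩ := hy
    exact ⟨a + b, by simp⟩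
  | smul a x _ hx =>
    obtain ⟨b, rfl⟩ := hx
    exact ⟨a * b, by simp [smul_eq_C_mul]⟩

theorem pderiv_eq_zero_of_isHomogeneous_zero {p : MvPolynomial σ ℝ} (hp : p.IsHomogeneous 0)
    (i : σ) : pderiv i p = 0 := by
  rw [totalDegree_eq_zero_iff_eq_C.1 ((totalDegree_zero_iff_isHomogeneous σ).2 hp), pderiv_C]

theorem pderiv_mem_parityDegreeLE {p : MvPolynomial σ ℝ} {d : ℕ}
    (hp : p ∈ parityDegreeLE σ (d + 1)) (i : σ) : pderiv i p ∈ parityDegreeLE σ d := by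
  induction hp using Submodule.span_induction with
  | mem p hp =>
    obtain ⟨m, k, h, hm⟩ := hp
    rcases m with _ | m
    · rw [pderiv_eq_zero_of_isHomogeneous_zero hm]; exact zero_mem _
    · obtain rfl : d = m + 2 * k := by omega
      exact isHomogeneous_mem_parityDegreeLE hm.pderiv
  | zero => simp
  | add x y _ _ hx hy => rw [map_add]; exact add_mem hx hy
  | smul a x _ hx => rw [Derivation.map_smul]; exact Submodule.smul_mem _ _ hx

variable [Fintype σ]

/-- The carré du champ operator `Γ(p, r) = ⟨∇p, ∇r⟩` on polynomials. -/
noncomputable def carreDuChamp (p r : MvPolynomial σ ℝ) : MvPolynomial σ ℝ :=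
  ∑ i, pderiv i p * pderiv i r

/-- The number operator `x · ∇ - Δ`, the negative of the Ornstein-Uhlenbeck generator. -/
noncomputable def numberOp : MvPolynomial σ ℝ →ₗ[ℝ] MvPolynomial σ ℝ :=
  ∑ i, (LinearMap.mulLeft ℝ (X i) ∘ₗ (pderiv i).toLinearMap
    - (pderiv i).toLinearMap ∘ₗ (pderiv i).toLinearMap)

theorem numberOp_apply (p : MvPolynomial σ ℝ) :
    numberOp p = ∑ i, (X i * pderiv i p - pderiv i (pderiv i p)) := by
  simp [numberOp]

theorem numberOp_C (c : ℝ) : numberOp (C c : MvPolynomial σ ℝ) = 0 := by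
  simp [numberOp_apply]

theorem carreDuChamp_comm (p r : MvPolynomial σ ℝ) : carreDuChamp p r = carreDuChamp r p :=
  sum_congr rfl fun _ _ => mul_comm _ _

theorem carreDuChamp_mul_right (p r t : MvPolynomial σ ℝ) :
    carreDuChamp p (r * t) = carreDuChamp p r * t + r * carreDuChamp p t := by
  simp only [carreDuChamp, sum_mul, mul_sum, ← sum_add_distrib, pderiv_mul]
  exact sum_congr rfl fun _ _ => by ring

theorem numberOp_mul (p r : MvPolynomial σ ℝ) :
    numberOp (p * r) = p * numberOp r + r * numberOp p - 2 * carreDuChamp p r := by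
  simp only [numberOp_apply, carreDuChamp, mul_sum, ← sum_add_distrib, ← sum_sub_distrib]
  refine sum_congr rfl fun i _ => ?_
  simp only [pderiv_mul, map_add]
  ring

theorem numberOp_pderiv (i : σ) (p : MvPolynomial σ ℝ) :
    numberOp (pderiv i p) = pderiv i (numberOp p) - pderiv i p := by
  classical
  have : pderiv i p = ∑ j, (Pi.single i 1 : σ → MvPolynomial σ ℝ) j * pderiv j p := by
    simp [Pi.single_apply, ite_mul]
  conv_rhs => rw [this]
  simp only [numberOp_apply, map_sum, ← sum_sub_distrib]
  refine sum_congr rfl fun j _ => ?_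
  rw [map_sub, pderiv_mul, pderiv_X, pderiv_pderiv_swap i j p,
    pderiv_pderiv_swap i j (pderiv j p), pderiv_pderiv_swap i j p, Pi.single_apply]
  ring

theorem numberOp_sub_mem_parityDegreeLE {p : MvPolynomial σ ℝ} {d : ℕ}
    (hp : p ∈ parityDegreeLE σ (d + 2)) :
    numberOp p - ((d + 2 : ℕ) : ℝ) • p ∈ parityDegreeLE σ d := by
  have hlap : ∑ i, pderiv i (pderiv i p) ∈ parityDegreeLE σ d :=
    sum_mem fun i _ => pderiv_mem_parityDegreeLE (pderiv_mem_parityDegreeLE hp i) i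
  have heuler : ∑ i, X i * pderiv i p - ((d + 2 : ℕ) : ℝ) • p ∈ parityDegreeLE σ d := by
    clear hlap
    induction hp using Submodule.span_induction with
    | mem p hp =>
      obtain ⟨m, k, h, hm⟩ := hp
      rw [hm.sum_X_mul_pderiv, ← Nat.cast_smul_eq_nsmul ℝ, ← sub_smul]
      rcases k with _ | k
      · rw [← h]; simp
      · obtain rfl : d = m + 2 * k := by omega
        exact Submodule.smul_mem _ _ (isHomogeneous_mem_parityDegreeLE hm)
    | zero => simp
    | add x y _ _ hx hy =>
      convert add_mem hx hy using 1
      simp only [map_add, mul_add, sum_add_distrib, smul_add]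
      abel
    | smul a x _ hx =>
      convert Submodule.smul_mem _ a hx using 1
      simp only [Derivation.map_smul, mul_smul_comm, smul_sub, smul_sum]
      rw [smul_comm]
  convert sub_mem heuler hlap using 1
  rw [numberOp_apply, sum_sub_distrib]
  abel

/-- Spectral decomposition of even polynomials along the number operator. -/
theorem exists_eigen_decomposition (m : ℕ) {p : MvPolynomial σ ℝ}
    (hp : p ∈ parityDegreeLE σ (2 * m)) :
    ∃ u : ℕ → MvPolynomial σ ℝ, (∀ j, numberOp (u j) = (2 * j : ℝ) • u j) ∧
      (∃ c, u 0 = C c) ∧ ∑ j ∈ range (m + 1), u j = p := by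
  induction m generalizing p with
  | zero =>
    obtain ⟨c, rfl⟩ := exists_eq_C_of_mem_parityDegreeLE_zero hp
    refine ⟨fun j => if j = 0 then C c else 0, fun j => ?_, ⟨c, by simp⟩, by simp⟩
    by_cases h : j = 0 <;> simp [h, numberOp_C]
  | succ m ih =>
    obtain ⟨v, hv, ⟨c, hc⟩, hsum⟩ := ih (numberOp_sub_mem_parityDegreeLE (d := 2 * m) hp)
    set a : ℕ → ℝ := fun j => (2 * j - (2 * (m + 1)))⁻¹
    set w := p - ∑ j ∈ range (m + 1), a j • v j with hw
    have hwN : numberOp w = (2 * (m + 1) : ℝ) • w := by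
      have h1 : numberOp p = ∑ j ∈ range (m + 1), v j + (2 * (m + 1) : ℝ) • p := by
        rw [hsum]; push_cast; rw [show (2 * (m : ℝ) + 2) = 2 * (m + 1) by ring]; abel
      have h2 : ∑ j ∈ range (m + 1), numberOp (a j • v j)
          = ∑ j ∈ range (m + 1), v j + (2 * (m + 1) : ℝ) • ∑ j ∈ range (m + 1), a j • v j := by
        rw [smul_sum, ← sum_add_distrib]
        refine sum_congr rfl fun j hj => ?_
        have hne : (2 * j - (2 * (m + 1)) : ℝ) ≠ 0 := by
          have : (j : ℝ) < m + 1 := by exact_mod_cast mem_range.1 hj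
          linarith
        have h3 : a j * (2 * j) = 1 + 2 * (m + 1) * a j := by
          linear_combination inv_mul_cancel₀ hne
        rw [map_smul, hv, smul_smul, h3, add_smul, one_smul, smul_smul]
      rw [hw, map_sub, map_sum, h1, h2, smul_sub]
      abel
    refine ⟨fun j => if j < m + 1 then a j • v j else if j = m + 1 then w else 0, fun j => ?_,
      ⟨a 0 * c, by simp [hc, smul_eq_C_mul]⟩, ?_⟩
    · dsimp only
      split_ifs with h1 h2
      · rw [map_smul, hv, smul_comm]
      · rw [hwN, h2]; push_cast; rfl
      · simp
    · rw [sum_range_succ, sum_congr rfl (g := fun j => a j • v j)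
        fun j hj => by simp [mem_range.1 hj]]
      simp [hw]

end GaussianPolynomials

section GaussianFunctional

open MvPolynomial Finset

/-- A positive normalised linear functional on polynomials satisfying the Gaussian integration by
parts formula. -/
structure IsGaussianFunctional {σ : Type} (E : MvPolynomial σ ℝ →ₗ[ℝ] ℝ) : Prop where
  map_one : E 1 = 1
  nonneg : ∀ p, (∀ x, 0 ≤ eval x p) → 0 ≤ E p
  ibp : ∀ i p, E (X i * p) = E (pderiv i p)

variable {σ : Type} {E : MvPolynomial σ ℝ →ₗ[ℝ] ℝ}

namespace IsGaussianFunctional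

theorem map_C (hE : IsGaussianFunctional E) (c : ℝ) : E (C c) = c := by
  have : (C c : MvPolynomial σ ℝ) = c • 1 := by rw [smul_eq_C_mul, mul_one]
  rw [this, map_smul, hE.map_one, smul_eq_mul, mul_one]

variable [Fintype σ]

theorem map_mul_numberOp (hE : IsGaussianFunctional E) (p r : MvPolynomial σ ℝ) :
    E (p * numberOp r) = E (carreDuChamp p r) := by
  rw [numberOp_apply, carreDuChamp, mul_sum, map_sum, map_sum]
  refine sum_congr rfl fun i _ => ?_
  rw [mul_sub, mul_left_comm, map_sub, hE.ibp, pderiv_mul, map_add]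
  ring

theorem map_mul_eq_zero (hE : IsGaussianFunctional E) {p r : MvPolynomial σ ℝ} {a b : ℝ}
    (hp : numberOp p = a • p) (hr : numberOp r = b • r) (hab : a ≠ b) : E (p * r) = 0 := by
  have h1 := hE.map_mul_numberOp p r
  have h2 := hE.map_mul_numberOp r p
  rw [carreDuChamp_comm, ← h1, hp, hr, mul_smul_comm, mul_smul_comm, map_smul, map_smul,
    mul_comm r p, smul_eq_mul, smul_eq_mul] at h2
  have h3 : (a - b) * E (p * r) = 0 := by linear_combination h2
  exact (mul_eq_zero.1 h3).resolve_left (sub_ne_zero.2 hab)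

theorem map_sum_mul_sum (hE : IsGaussianFunctional E) {u : ℕ → MvPolynomial σ ℝ}
    (hu : ∀ j, numberOp (u j) = (2 * j : ℝ) • u j) (s : Finset ℕ) (a b : ℕ → ℝ) :
    E ((∑ j ∈ s, a j • u j) * ∑ j ∈ s, b j • u j) = ∑ j ∈ s, a j * b j * E (u j * u j) := by
  rw [sum_mul_sum, map_sum]
  refine sum_congr rfl fun i hi => ?_
  rw [map_sum, sum_eq_single i]
  · rw [smul_mul_smul_comm, map_smul, smul_eq_mul]
  · intro j _ hj
    rw [smul_mul_smul_comm, map_smul, hE.map_mul_eq_zero (hu i) (hu j), smul_zero]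
    simpa using hj.symm
  · exact fun h => absurd hi h

/-- Hypercontractivity from `L²` to `L⁴` for vectors with components in a fixed chaos. -/
theorem map_sq_sum_sq_le (hE : IsGaussianFunctional E) (d : ℕ) {κ : Type} [Fintype κ]
    (G : κ → MvPolynomial σ ℝ) (hG : ∀ j, G j ∈ parityDegreeLE σ d)
    (hN : ∀ j, numberOp (G j) = (d : ℝ) • G j) :
    E ((∑ j, G j * G j) * ∑ j, G j * G j) ≤ 9 ^ d * E (∑ j, G j * G j) ^ 2 := by
  induction d generalizing κ with
  | zero =>
    choose c hc using fun j => exists_eq_C_of_mem_parityDegreeLE_zero (hG j)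
    have : ∑ j, G j * G j = C (∑ j, c j * c j) := by simp [hc]
    rw [this, ← C_mul, hE.map_C, hE.map_C]
    simp [sq]
  | succ d ih =>
    set S := ∑ j, G j * G j with hS
    set T := ∑ j, carreDuChamp (G j) (G j) with hT
    set R := ∑ i, (∑ j, G j * pderiv i (G j)) * ∑ j, G j * pderiv i (G j) with hR
    have hTsum : T = ∑ x : κ × σ, pderiv x.2 (G x.1) * pderiv x.2 (G x.1) := by
      rw [hT, Fintype.sum_prod_type]; rfl
    have hTT : E (T * T) ≤ 9 ^ d * E T ^ 2 := by
      rw [hTsum]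
      refine ih _ (fun x => pderiv_mem_parityDegreeLE (hG x.1) x.2) fun x => ?_
      rw [numberOp_pderiv, hN, Derivation.map_smul]
      push_cast
      rw [add_smul, one_smul, add_sub_cancel_right]
    have hET : E T = (d + 1 : ℝ) * E S := by
      rw [hT, hS, map_sum, map_sum, mul_sum]
      refine sum_congr rfl fun j _ => ?_
      rw [← hE.map_mul_numberOp, hN, mul_smul_comm, map_smul, smul_eq_mul]
      push_cast
      rfl
    have hESS : (d + 1 : ℝ) * E (S * S) = E (T * S) + 2 * E R := by
      have h1 : (d + 1 : ℝ) * E (S * S) = ∑ j, E (G j * S * numberOp (G j)) := by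
        conv_lhs => rw [hS, sum_mul, map_sum, mul_sum]
        refine sum_congr rfl fun j _ => ?_
        rw [hN, mul_smul_comm, map_smul, smul_eq_mul, mul_right_comm]
        push_cast
        rfl
      have h2 : ∑ j, carreDuChamp (G j * S) (G j) = T * S + (2 : ℝ) • R := by
        have h3 : ∀ i, pderiv i S = (2 : ℝ) • ∑ j, G j * pderiv i (G j) := fun i => by
          rw [hS, map_sum, smul_sum]
          refine sum_congr rfl fun j _ => ?_
          rw [pderiv_mul, two_smul]
          ring
        simp_rw [carreDuChamp_comm (G _ * S), carreDuChamp_mul_right]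
        rw [sum_add_distrib, ← sum_mul, hR, smul_sum]
        congr 1
        simp_rw [carreDuChamp, h3, mul_sum]
        rw [sum_comm]
        refine sum_congr rfl fun i _ => ?_
        set A := ∑ j, G j * pderiv i (G j) with hA
        rw [← mul_sum, ← hA, ← smul_mul_assoc]
        nth_rewrite 3 [hA]
        rw [mul_sum]
        exact sum_congr rfl fun j _ => by ring
      rw [h1]
      simp_rw [hE.map_mul_numberOp]
      rw [← map_sum, h2, map_add, map_smul, smul_eq_mul]
    have hR_le : E R ≤ E (T * S) := by
      rw [← sub_nonneg, ← map_sub]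
      refine hE.nonneg _ fun x => ?_
      simp only [hT, hS, hR, carreDuChamp, map_sub, map_sum, map_mul]
      rw [sub_nonneg, sum_comm, sum_mul]
      refine sum_le_sum fun i _ => ?_
      have := sum_mul_sq_le_sq_mul_sq univ (fun j => eval x (G j))
        fun j => eval x (pderiv i (G j))
      simp only [sq] at this
      linarith
    have hsq : 0 ≤ 9 * E (T * T) - 6 * (d + 1) * E (T * S) + (d + 1) ^ 2 * E (S * S) := by
      have := hE.nonneg (((3 : ℝ) • T - (d + 1 : ℝ) • S) * ((3 : ℝ) • T - (d + 1 : ℝ) • S))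
        fun x => by rw [map_mul]; exact mul_self_nonneg _
      have h : ((3 : ℝ) • T - (d + 1 : ℝ) • S) * ((3 : ℝ) • T - (d + 1 : ℝ) • S)
          = (9 : ℝ) • (T * T) - (6 * (d + 1) : ℝ) • (T * S) + ((d + 1) ^ 2 : ℝ) • (S * S) := by
        simp only [smul_eq_C_mul, map_mul, map_add, map_pow]
        have h3 : (C 3 : MvPolynomial σ ℝ) = 3 := map_ofNat C 3
        have h6 : (C 6 : MvPolynomial σ ℝ) = 6 := map_ofNat C 6
        have h9 : (C 9 : MvPolynomial σ ℝ) = 9 := map_ofNat C 9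
        rw [h3, h6, h9]
        ring
      rw [h] at this
      simpa using this
    have hd : (0 : ℝ) < d + 1 := by positivity
    have hfin : (d + 1 : ℝ) ^ 2 * E (S * S) ≤ (d + 1) ^ 2 * (9 ^ (d + 1) * E S ^ 2) := by
      rw [hET] at hTT
      have : (d + 1 : ℝ) * ((d + 1) * E (S * S)) ≤ (d + 1) * (3 * E (T * S)) :=
        mul_le_mul_of_nonneg_left (by linarith) hd.le
      rw [pow_succ (9 : ℝ) d]
      nlinarith
    exact le_of_mul_le_mul_left hfin (by positivity)

theorem map_pow_four_le (hE : IsGaussianFunctional E) {d : ℕ} {F : MvPolynomial σ ℝ}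
    (hF : F ∈ parityDegreeLE σ d) (hN : numberOp F = (d : ℝ) • F) :
    E (F ^ 4) ≤ 9 ^ d * E (F ^ 2) ^ 2 := by
  have := hE.map_sq_sum_sq_le d (fun _ : Unit => F) (fun _ => hF) fun _ => hN
  simp only [univ_unique, sum_const, card_singleton, one_smul] at this
  convert this using 3 <;> ring_nf

/-- The spectral gap estimate behind the fourth moment theorem. -/
theorem fourth_moment (hE : IsGaussianFunctional E) {q : ℕ} (hq : 1 ≤ q) {F : MvPolynomial σ ℝ}
    (hF : F ∈ parityDegreeLE σ q) (hN : numberOp F = (q : ℝ) • F) :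
    3 * E (F ^ 2) ^ 2 ≤ E (F ^ 4) ∧
      E ((C (E (F ^ 2)) - (q : ℝ)⁻¹ • carreDuChamp F F) ^ 2)
        ≤ (q - 1) / (3 * q) * (E (F ^ 4) - 3 * E (F ^ 2) ^ 2) := by
  set s := E (F ^ 2)
  set U := F ^ 2 with hU
  set Γ := carreDuChamp F F with hΓ
  have hqpos : (0 : ℝ) < q := by exact_mod_cast hq
  obtain ⟨u, hu, ⟨c, hc⟩, hsum⟩ := exists_eigen_decomposition q (p := U) (by
    rw [hU, sq, two_mul]; exact mul_mem_parityDegreeLE hF hF)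
  have hNU : numberOp U = (2 * q : ℝ) • U - (2 : ℝ) • Γ := by
    rw [hU, sq, numberOp_mul, hN, hΓ, two_smul, two_mul (q : ℝ), add_smul, mul_smul_comm]
    ring
  have hΓsum : Γ = ∑ j ∈ range (q + 1), (q - j : ℝ) • u j := by
    have h1 : (2 : ℝ) • Γ = (2 : ℝ) • ∑ j ∈ range (q + 1), (q - j : ℝ) • u j := by
      have : (2 : ℝ) • Γ = (2 * q : ℝ) • U - numberOp U := by rw [hNU]; abel
      rw [this, ← hsum, map_sum, smul_sum, smul_sum, ← sum_sub_distrib]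
      refine sum_congr rfl fun j _ => ?_
      rw [hu, smul_smul, ← sub_smul]
      congr 1
      ring
    exact smul_right_injective _ two_ne_zero h1
  have hs : s = c := by
    change E U = c
    rw [← hsum, map_sum, sum_range_succ', hc, hE.map_C, sum_eq_zero, zero_add]
    intro j _
    have := hE.map_mul_eq_zero (hu (j + 1)) (a := 2 * (j + 1 : ℕ)) (b := 0)
      (r := 1) (by rw [zero_smul, ← C_1, numberOp_C]) (by positivity)
    rwa [mul_one] at this
  have hUU : E (U * Γ) = ∑ j ∈ range (q + 1), (q - j : ℝ) * E (u j * u j) := by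
    have := hE.map_sum_mul_sum hu (range (q + 1)) (fun _ => 1) (fun j => q - j)
    simp only [one_smul, one_mul] at this
    rw [← this, ← hΓsum, hsum]
  have h4 : (q : ℝ) * E (F ^ 4) = 3 * E (U * Γ) := by
    have h1 := hE.map_mul_numberOp (F * (F * F)) F
    rw [carreDuChamp_comm, carreDuChamp_mul_right, carreDuChamp_mul_right, hN, mul_smul_comm,
      map_smul, smul_eq_mul] at h1
    rw [show F ^ 4 = F * (F * F) * F by ring, h1, ← smul_eq_mul (3 : ℝ), ← map_smul]
    congr 1
    rw [hU, smul_eq_C_mul, show (C 3 : MvPolynomial σ ℝ) = 3 from map_ofNat C 3, ← hΓ]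
    ring
  have hpos : ∀ j, 0 ≤ E (u j * u j) := fun j => hE.nonneg _ fun x => by
    rw [map_mul]; exact mul_self_nonneg _
  have hUU' : E (U * Γ) - q * s ^ 2
      = ∑ j ∈ range q, (q - (j + 1) : ℝ) * E (u (j + 1) * u (j + 1)) := by
    rw [hUU, sum_range_succ', hc, ← C_mul, hE.map_C, hs]
    push_cast
    ring
  have hdiff : E (F ^ 4) - 3 * s ^ 2 = 3 / q * (E (U * Γ) - q * s ^ 2) := by
    field_simp
    linarith
  have hnn : 0 ≤ E (U * Γ) - q * s ^ 2 := by
    rw [hUU']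
    refine sum_nonneg fun j hj => mul_nonneg ?_ (hpos _)
    have : ((j + 1 : ℕ) : ℝ) ≤ q := by exact_mod_cast mem_range.1 hj
    push_cast at this
    linarith
  have hvar : E ((C s - (q : ℝ)⁻¹ • Γ) ^ 2)
      = ∑ j ∈ range q, (1 - (j + 1) / q : ℝ) ^ 2 * E (u (j + 1) * u (j + 1)) := by
    have h1 : C s - (q : ℝ)⁻¹ • Γ
        = ∑ j ∈ range q, (-(1 - (j + 1) / q) : ℝ) • u (j + 1) := by
      rw [hΓsum, sum_range_succ', hc, hs, smul_add, smul_smul, smul_sum, Nat.cast_zero, sub_zero,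
        inv_mul_cancel₀ hqpos.ne', one_smul, sub_add_cancel_right, ← sum_neg_distrib]
      refine sum_congr rfl fun j _ => ?_
      rw [smul_smul, ← neg_smul]
      congr 1
      push_cast
      field_simp
    have h2 := hE.map_sum_mul_sum hu ((range q).map ⟨_, Nat.succ_injective⟩)
      (fun j => -(1 - j / q)) (fun j => -(1 - j / q))
    simp only [sum_map, Function.Embedding.coeFn_mk, Nat.succ_eq_add_one] at h2
    push_cast at h2
    rw [h1, sq, h2]
    exact sum_congr rfl fun j _ => by ring
  refine ⟨?_, ?_⟩
  · have : 0 ≤ 3 / q * (E (U * Γ) - q * s ^ 2) := by positivity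
    linarith
  · rw [hvar, hdiff, ← mul_assoc, hUU', mul_sum]
    refine sum_le_sum fun j hj => ?_
    rw [← mul_assoc]
    refine mul_le_mul_of_nonneg_right ?_ (hpos _)
    have h1 : ((j + 1 : ℕ) : ℝ) ≤ q := by exact_mod_cast mem_range.1 hj
    push_cast at h1
    have h2 : (1 - (j + 1) / q : ℝ) = (q - (j + 1)) / q := by field_simp
    rw [h2, show ((q : ℝ) - 1) / (3 * q) * (3 / q) * (q - (j + 1))
      = (q - 1) * (q - (j + 1)) / q ^ 2 by field_simp, div_pow]
    gcongr
    have : (0 : ℝ) ≤ j := by positivity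
    nlinarith

end IsGaussianFunctional

end GaussianFunctional

section GaussianIntegration

open MvPolynomial

theorem hasDerivAt_gaussianPDFReal_standard (x : ℝ) :
    HasDerivAt (gaussianPDFReal 0 1) (-(x * gaussianPDFReal 0 1 x)) x := by
  have h : HasDerivAt (fun y : ℝ => -(y - 0) ^ 2 / (2 * ((1 : NNReal) : ℝ))) (-x) x := by
    refine (((((hasDerivAt_id x).sub_const 0).fun_pow 2).fun_neg).div_const
      (2 * ((1 : NNReal) : ℝ))).congr_deriv ?_
    simp
    ring
  refine ((h.exp).const_mul (√(2 * Real.pi * ((1 : NNReal) : ℝ)))⁻¹).congr_deriv ?_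
  rw [gaussianPDFReal]
  ring

theorem integrable_gaussianReal_iff {g : ℝ → ℝ} :
    Integrable g (gaussianReal 0 1) ↔ Integrable fun x => g x * gaussianPDFReal 0 1 x := by
  rw [gaussianReal_of_var_ne_zero 0 one_ne_zero,
    integrable_withDensity_iff (measurable_gaussianPDF 0 1)
      (ae_of_all _ fun _ => gaussianPDF_lt_top)]
  simp [toReal_gaussianPDF]

theorem integral_gaussianReal_standard (g : ℝ → ℝ) :
    ∫ x, g x ∂gaussianReal 0 1 = ∫ x, g x * gaussianPDFReal 0 1 x := by
  rw [integral_gaussianReal_eq_integral_smul one_ne_zero]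
  simp [mul_comm]

/-- Gaussian integration by parts in dimension one. -/
theorem integral_id_mul_gaussianReal {u u' : ℝ → ℝ} (hu : ∀ x, HasDerivAt u (u' x) x)
    (h0 : Integrable u (gaussianReal 0 1)) (h1 : Integrable u' (gaussianReal 0 1))
    (h2 : Integrable (fun x => x * u x) (gaussianReal 0 1)) :
    ∫ x, x * u x ∂gaussianReal 0 1 = ∫ x, u' x ∂gaussianReal 0 1 := by
  rw [integrable_gaussianReal_iff] at h0 h1 h2
  rw [integral_gaussianReal_standard, integral_gaussianReal_standard]
  have := integral_mul_deriv_eq_deriv_mul_of_integrable (u := u) (v := gaussianPDFReal 0 1)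
    (fun x _ => hu x) (fun x _ => hasDerivAt_gaussianPDFReal_standard x)
    (h2.neg.congr (ae_of_all _ fun x => by simp only [Pi.neg_apply, Pi.mul_apply]; ring)) h1 h0
  rw [← neg_inj, ← this, ← integral_neg]
  exact integral_congr_ae (ae_of_all _ fun x => by simp only; ring)

/-- The standard Gaussian measure on `ℝⁿ`. -/
noncomputable abbrev stdGaussianPi (n : ℕ) : Measure (Fin n → ℝ) :=
  Measure.pi fun _ => gaussianReal 0 1

/-- Gaussian integration by parts in finite dimension. -/
theorem integral_coord_mul_stdGaussianPi {n : ℕ} (i : Fin n) {u u' : (Fin n → ℝ) → ℝ}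
    (hu : ∀ x, HasDerivAt (fun t => u (Function.update x i t)) (u' x) (x i))
    (h0 : Integrable u (stdGaussianPi n)) (h1 : Integrable u' (stdGaussianPi n))
    (h2 : Integrable (fun x => x i * u x) (stdGaussianPi n)) :
    ∫ x, x i * u x ∂stdGaussianPi n = ∫ x, u' x ∂stdGaussianPi n := by
  obtain _ | n := n
  · exact i.elim0
  have hmp := (measurePreserving_piFinSuccAbove (fun _ : Fin (n + 1) => gaussianReal 0 1) i).symm
  rw [← hmp.integrable_comp_emb (MeasurableEquiv.measurableEmbedding _)] at h0 h1 h2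
  rw [← hmp.integral_comp', ← hmp.integral_comp']
  refine (integral_prod_symm _ h2).trans (Eq.trans ?_ (integral_prod_symm _ h1).symm)
  refine integral_congr_ae ?_
  filter_upwards [h0.prod_left_ae, h1.prod_left_ae, h2.prod_left_ae] with y hy0 hy1 hy2
  simp only [Function.comp_def, MeasurableEquiv.piFinSuccAbove_symm_apply, Fin.insertNthEquiv,
    Equiv.coe_fn_mk, Fin.insertNth_apply_same] at hy0 hy1 hy2 ⊢
  refine integral_id_mul_gaussianReal (fun t => ?_) hy0 hy1 hy2
  have := hu (i.insertNth t y)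
  simpa only [Fin.update_insertNth, Fin.insertNth_apply_same] using this

theorem hasDerivAt_eval_update {n : ℕ} (p : MvPolynomial (Fin n) ℝ) (i : Fin n) (x : Fin n → ℝ) :
    HasDerivAt (fun t => eval (Function.update x i t) p) (eval x (pderiv i p)) (x i) := by
  induction p using MvPolynomial.induction_on with
  | C a => simpa using hasDerivAt_const (x i) a
  | add p r hp hr => simpa using hp.fun_add hr
  | mul_X p j hp =>
    have hX : HasDerivAt (fun t => Function.update x i t j) (eval x (pderiv i (X j))) (x i) := by
      by_cases h : j = i
      · subst h; simpa using hasDerivAt_id' (x j)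
      · simpa [Function.update_of_ne h, pderiv_X_of_ne h] using hasDerivAt_const (x i) (x j)
    have := hp.fun_mul hX
    simp only [Function.update_eq_self] at this
    simpa [pderiv_mul, mul_comm, add_comm] using this

theorem integrable_eval_stdGaussianPi {n : ℕ} (p : MvPolynomial (Fin n) ℝ) :
    Integrable (fun x => eval x p) (stdGaussianPi n) := by
  induction p using MvPolynomial.induction_on' with
  | monomial s a =>
    simp only [eval_monomial, Finsupp.prod_fintype _ _ fun _ => pow_zero _]
    refine (Integrable.fintype_prod (f := fun i y => y ^ s i) fun i => ?_).const_mul a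
    have := (memLp_id_gaussianReal (μ := 0) (v := 1) (s i)).integrable_norm_pow'
    refine this.mono (by fun_prop) (ae_of_all _ fun x => by simp)
  | add p r hp hr => simp only [map_add]; exact hp.add hr

/-- The expectation functional on polynomials in independent standard Gaussian variables. -/
noncomputable def gaussianExpectation (n : ℕ) : MvPolynomial (Fin n) ℝ →ₗ[ℝ] ℝ where
  toFun p := ∫ x, eval x p ∂stdGaussianPi n
  map_add' p r := by
    simp only [map_add]
    exact integral_add (integrable_eval_stdGaussianPi p) (integrable_eval_stdGaussianPi r)
  map_smul' c p := by
    simp only [smul_eval, RingHom.id_apply, smul_eq_mul]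
    exact integral_const_mul _ _

theorem gaussianExpectation_apply {n : ℕ} (p : MvPolynomial (Fin n) ℝ) :
    gaussianExpectation n p = ∫ x, eval x p ∂stdGaussianPi n := rfl

theorem isGaussianFunctional_gaussianExpectation (n : ℕ) :
    IsGaussianFunctional (gaussianExpectation n) where
  map_one := by simp [gaussianExpectation_apply]
  nonneg p hp := integral_nonneg hp
  ibp i p := by
    simp only [gaussianExpectation_apply, map_mul, eval_X]
    refine integral_coord_mul_stdGaussianPi i (hasDerivAt_eval_update p i)
      (integrable_eval_stdGaussianPi _) (integrable_eval_stdGaussianPi _) ?_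
    exact (integrable_eval_stdGaussianPi (X i * p)).congr (ae_of_all _ fun x => by simp)

theorem abs_le_of_hasDerivAt_of_abs_le {f f' : ℝ → ℝ} (hf : ∀ x, HasDerivAt f (f' x) x)
    (hf' : ∀ x, |f' x| ≤ 1) (x : ℝ) : |f x| ≤ |f 0| + |x| := by
  have := convex_univ.norm_image_sub_le_of_norm_hasDerivWithin_le (f := f) (f' := f') (C := 1)
    (fun y _ => (hf y).hasDerivWithinAt) (fun y _ => by simpa using hf' y)
    (Set.mem_univ 0) (Set.mem_univ x)
  simp only [Real.norm_eq_abs, sub_zero, one_mul] at this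
  have h2 := abs_sub_abs_le_abs_sub (f x) (f 0)
  linarith

theorem integrable_eval_mul {n : ℕ} (p F : MvPolynomial (Fin n) ℝ) {g : ℝ → ℝ} {c : ℝ}
    (hg : Measurable g) (hc : ∀ y, |g y| ≤ c + |y|) :
    Integrable (fun x => eval x p * g (eval x F)) (stdGaussianPi n) := by
  have hb : Integrable (fun x => c * |eval x p| + |eval x (p * F)|) (stdGaussianPi n) :=
    ((integrable_eval_stdGaussianPi p).abs.const_mul c).add
      (integrable_eval_stdGaussianPi (p * F)).abs
  have hm : ∀ p : MvPolynomial (Fin n) ℝ, Measurable fun x => eval x p := fun p =>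
    (MvPolynomial.continuous_eval p).measurable
  refine hb.mono' ((hm p).mul (hg.comp (hm F))).aestronglyMeasurable (ae_of_all _ fun x => ?_)
  rw [Real.norm_eq_abs, abs_mul, map_mul, abs_mul]
  nlinarith [hc (eval x F), abs_nonneg (eval x p)]

/-- Integration by parts against the carré du champ for an eigenvector of the number operator. -/
theorem integral_eval_mul_comp {n : ℕ} {F : MvPolynomial (Fin n) ℝ} {c : ℝ}
    (hN : numberOp F = c • F) {f f' : ℝ → ℝ} (hf : ∀ x, HasDerivAt f (f' x) x)
    (hf'm : Measurable f') (hf' : ∀ x, |f' x| ≤ 1) :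
    c * ∫ x, eval x F * f (eval x F) ∂stdGaussianPi n
      = ∫ x, eval x (carreDuChamp F F) * f' (eval x F) ∂stdGaussianPi n := by
  have hfm : Measurable f := (continuous_iff_continuousAt.2 fun x => (hf x).continuousAt).measurable
  have hfb := abs_le_of_hasDerivAt_of_abs_le hf hf'
  have hf'b : ∀ y, |f' y| ≤ 1 + |y| := fun y => (hf' y).trans (by linarith [abs_nonneg y])
  have hint : ∀ p, Integrable (fun x => eval x p * f (eval x F)) (stdGaussianPi n) := fun p =>
    integrable_eval_mul p F hfm hfb
  have hint' : ∀ p, Integrable (fun x => eval x p * f' (eval x F)) (stdGaussianPi n) := fun p =>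
    integrable_eval_mul p F hf'm hf'b
  have key : ∀ i, ∫ x, eval x (X i * pderiv i F - pderiv i (pderiv i F)) * f (eval x F)
      ∂stdGaussianPi n = ∫ x, eval x (pderiv i F * pderiv i F) * f' (eval x F)
      ∂stdGaussianPi n := by
    intro i
    have h1 := integral_coord_mul_stdGaussianPi i
      (u := fun x => eval x (pderiv i F) * f (eval x F))
      (u' := fun x => eval x (pderiv i (pderiv i F)) * f (eval x F)
        + eval x (pderiv i F * pderiv i F) * f' (eval x F)) (fun x => by
        have h := hasDerivAt_eval_update F i x
        have h2 := (hf (eval (Function.update x i (x i)) F)).comp (x i) h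
        refine ((hasDerivAt_eval_update (pderiv i F) i x).fun_mul h2).congr_deriv ?_
        simp only [Function.update_eq_self, Function.comp_apply, map_mul]
        ring) (hint _) ((hint _).add (hint' _)) (by
          convert hint (X i * pderiv i F) using 2
          rw [map_mul, eval_X]
          ring)
    rw [integral_add (hint _) (hint' _)] at h1
    rw [← sub_eq_iff_eq_add'.2 h1, ← integral_sub _ (hint _)]
    · refine integral_congr_ae (ae_of_all _ fun x => ?_)
      simp only [map_sub, map_mul, eval_X]
      ring
    · convert hint (X i * pderiv i F) using 2
      rw [map_mul, eval_X]
      ring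
  have h2 : ∀ x, c * (eval x F * f (eval x F))
      = ∑ i, eval x (X i * pderiv i F - pderiv i (pderiv i F)) * f (eval x F) := fun x => by
    rw [← Finset.sum_mul, ← map_sum, ← numberOp_apply, hN, smul_eval]
    ring
  rw [← integral_const_mul]
  simp_rw [h2, carreDuChamp, map_sum, Finset.sum_mul]
  rw [integral_finsetSum _ fun i _ => hint _, integral_finsetSum _ fun i _ => hint' _]
  exact Finset.sum_congr rfl fun i _ => key i

theorem integral_abs_le_sqrt {α : Type*} [MeasurableSpace α] {μ : Measure α}
    [IsProbabilityMeasure μ] {g : α → ℝ} (hg : MemLp g 2 μ) :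
    ∫ x, |g x| ∂μ ≤ √(∫ x, g x ^ 2 ∂μ) := by
  have h := variance_nonneg |g| μ
  rw [variance_eq_sub hg.abs] at h
  refine Real.le_sqrt_of_sq_le ?_
  simpa using h

/-- The Malliavin-Stein bound with the fourth moment for a polynomial in a fixed chaos. -/
theorem abs_integral_stein_le {n q : ℕ} (hq : 1 ≤ q) {F : MvPolynomial (Fin n) ℝ}
    (hF : F ∈ parityDegreeLE (Fin n) q) (hN : numberOp F = (q : ℝ) • F)
    {f f' : ℝ → ℝ} (hf : ∀ x, HasDerivAt f (f' x) x)
    (hf'm : Measurable f') (hf' : ∀ x, |f' x| ≤ 1) :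
    |∫ x, (f' (eval x F) - eval x F * f (eval x F)) ∂stdGaussianPi n|
      ≤ |1 - gaussianExpectation n (F ^ 2)| + √((q - 1) / (3 * q) *
        (gaussianExpectation n (F ^ 4) - 3 * gaussianExpectation n (F ^ 2) ^ 2)) := by
  have hfm : Measurable f := (continuous_iff_continuousAt.2 fun x => (hf x).continuousAt).measurable
  have hqpos : (0 : ℝ) < q := by exact_mod_cast hq
  have hf'b : ∀ y, |f' y| ≤ 1 + |y| := fun y => (hf' y).trans (by linarith [abs_nonneg y])
  have hint : ∀ p, Integrable (fun x => eval x p * f (eval x F)) (stdGaussianPi n) := fun p =>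
    integrable_eval_mul p F hfm (abs_le_of_hasDerivAt_of_abs_le hf hf')
  have hint' : ∀ p, Integrable (fun x => eval x p * f' (eval x F)) (stdGaussianPi n) := fun p =>
    integrable_eval_mul p F hf'm hf'b
  set s := gaussianExpectation n (F ^ 2)
  set Γ := carreDuChamp F F
  set V := C s - (q : ℝ)⁻¹ • Γ with hV
  have h1 : ∫ x, (f' (eval x F) - eval x F * f (eval x F)) ∂stdGaussianPi n
      = ∫ x, eval x (1 - (q : ℝ)⁻¹ • Γ) * f' (eval x F) ∂stdGaussianPi n := by
    have h2 := integral_eval_mul_comp hN hf hf'm hf'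
    have h3 : ∫ x, eval x F * f (eval x F) ∂stdGaussianPi n
        = (q : ℝ)⁻¹ * ∫ x, eval x Γ * f' (eval x F) ∂stdGaussianPi n := by
      rw [← h2, inv_mul_cancel_left₀ hqpos.ne']
    have h4 : Integrable (fun x => f' (eval x F)) (stdGaussianPi n) := by simpa using hint' 1
    rw [integral_sub h4 (hint F), h3, ← integral_const_mul, ← integral_sub h4]
    · refine integral_congr_ae (ae_of_all _ fun x => ?_)
      simp only [map_sub, map_one, smul_eval]
      ring
    · exact (hint' Γ).const_mul _
  have hpt : ∀ x, ‖eval x (1 - (q : ℝ)⁻¹ • Γ) * f' (eval x F)‖ ≤ |1 - s| + |eval x V| := by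
    intro x
    rw [Real.norm_eq_abs, abs_mul]
    have h2 : eval x (1 - (q : ℝ)⁻¹ • Γ) = (1 - s) + eval x V := by
      simp [hV]
    rw [h2]
    calc _ ≤ |1 - s + eval x V| * 1 := mul_le_mul_of_nonneg_left (hf' _) (abs_nonneg _)
      _ ≤ _ := by rw [mul_one]; exact abs_add_le _ _
  have hVi := integrable_eval_stdGaussianPi V
  have hV2 : MemLp (fun x => eval x V) 2 (stdGaussianPi n) := by
    rw [memLp_two_iff_integrable_sq hVi.aestronglyMeasurable]
    exact (integrable_eval_stdGaussianPi (V ^ 2)).congr (ae_of_all _ fun x => by simp)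
  rw [h1]
  refine (norm_integral_le_of_norm_le ((integrable_const _).add hVi.abs)
    (ae_of_all _ hpt)).trans ?_
  rw [integral_add' (integrable_const _) hVi.abs, integral_const, probReal_univ, one_smul]
  gcongr
  refine (integral_abs_le_sqrt hV2).trans (Real.sqrt_le_sqrt ?_)
  have := ((isGaussianFunctional_gaussianExpectation n).fourth_moment hq hF hN).2
  rw [gaussianExpectation_apply] at this
  simpa [hV] using this

end GaussianIntegration

section SteinEquation

open Set Filter Topology

theorem continuous_gaussianPDFReal_standard : Continuous (gaussianPDFReal 0 1) :=
  continuous_iff_continuousAt.2 fun x => (hasDerivAt_gaussianPDFReal_standard x).continuousAt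

theorem integrable_id_mul_gaussianPDFReal : Integrable fun x => x * gaussianPDFReal 0 1 x :=
  integrable_gaussianReal_iff.1 (memLp_one_iff_integrable.1 (memLp_id_gaussianReal 1))

theorem mul_integral_Ioi_gaussianPDFReal_le (x : ℝ) :
    x * ∫ t in Ioi x, gaussianPDFReal 0 1 t ≤ gaussianPDFReal 0 1 x := by
  have hi := integrable_gaussianPDFReal 0 1
  have hi' := integrable_id_mul_gaussianPDFReal.neg
  have h := integral_Ioi_of_hasDerivAt_of_tendsto' (a := x)
    (fun y _ => hasDerivAt_gaussianPDFReal_standard y) hi'.integrableOn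
    (tendsto_zero_of_hasDerivAt_of_integrableOn_Ioi (a := x)
      (fun y _ => hasDerivAt_gaussianPDFReal_standard y) hi'.integrableOn hi.integrableOn)
  rw [integral_neg, zero_sub, neg_inj] at h
  rw [← h, ← integral_const_mul]
  refine setIntegral_mono_on (hi.const_mul x).integrableOn
    integrable_id_mul_gaussianPDFReal.integrableOn measurableSet_Ioi fun t ht => ?_
  exact mul_le_mul_of_nonneg_right (le_of_lt ht) (gaussianPDFReal_nonneg _ _ _)

theorem neg_mul_integral_Iic_gaussianPDFReal_le (x : ℝ) :
    -x * ∫ t in Iic x, gaussianPDFReal 0 1 t ≤ gaussianPDFReal 0 1 x := by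
  have hi := integrable_gaussianPDFReal 0 1
  have hi' := integrable_id_mul_gaussianPDFReal.neg
  have h := integral_Iic_of_hasDerivAt_of_tendsto' (a := x)
    (fun y _ => hasDerivAt_gaussianPDFReal_standard y) hi'.integrableOn
    (tendsto_zero_of_hasDerivAt_of_integrableOn_Iic (a := x)
      (fun y _ => hasDerivAt_gaussianPDFReal_standard y) hi'.integrableOn hi.integrableOn)
  rw [sub_zero] at h
  rw [← h, ← integral_const_mul]
  refine setIntegral_mono_on (hi.const_mul (-x)).integrableOn hi'.integrableOn
    measurableSet_Iic fun t ht => ?_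
  rw [neg_mul, neg_le_neg_iff]
  exact mul_le_mul_of_nonneg_right ht (gaussianPDFReal_nonneg _ _ _)

/-- For a continuous antitone `h` with values in `[0, 1]`, Stein's equation
`f' - x f = h - E h(N)` has a solution with `|f'| ≤ 1`. -/
theorem exists_stein_solution {h : ℝ → ℝ} (hc : Continuous h) (ha : Antitone h)
    (h0 : ∀ x, 0 ≤ h x) (h1 : ∀ x, h x ≤ 1) :
    ∃ f f' : ℝ → ℝ, (∀ x, HasDerivAt f (f' x) x) ∧ Measurable f' ∧ (∀ x, |f' x| ≤ 1) ∧
      ∀ x, f' x - x * f x = h x - ∫ y, h y ∂gaussianReal 0 1 := by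
  set φ := gaussianPDFReal 0 1 with hφ
  set c := ∫ y, h y ∂gaussianReal 0 1 with hc_def
  have hφpos : ∀ x, 0 < φ x := fun x => gaussianPDFReal_pos 0 1 x one_ne_zero
  have hφi : Integrable φ := integrable_gaussianPDFReal 0 1
  have hφc : Continuous φ := continuous_gaussianPDFReal_standard
  have hhi : Integrable h (gaussianReal 0 1) :=
    Integrable.of_bound hc.aestronglyMeasurable 1 (ae_of_all _ fun x => by
      rw [Real.norm_eq_abs, abs_of_nonneg (h0 x)]; exact h1 x)
  have hc0 : 0 ≤ c := integral_nonneg h0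
  have hc1 : c ≤ 1 := by
    have := integral_mono hhi (integrable_const 1) h1
    simpa using this
  have hhφ := integrable_gaussianReal_iff.1 hhi
  set g : ℝ → ℝ := fun x => (h x - c) * φ x with hg
  have hgc : Continuous g := (hc.sub continuous_const).mul hφc
  have hgi : Integrable g := by
    have := hhφ.sub (hφi.const_mul c)
    exact this.congr (ae_of_all _ fun x => by simp only [hg, Pi.sub_apply]; ring)
  have hg0 : ∫ x, g x = 0 := by
    have : ∀ x, g x = h x * φ x - c * φ x := fun x => by simp only [hg]; ring
    simp_rw [this]
    rw [integral_sub hhφ (hφi.const_mul c), integral_const_mul,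
      integral_gaussianPDFReal_eq_one 0 one_ne_zero, hc_def, integral_gaussianReal_standard]
    ring
  set A : ℝ → ℝ := fun x => ∫ t in Iic x, g t with hA
  have hA' : ∀ x, A x = -∫ t in Ioi x, g t := fun x => by
    have := intervalIntegral.integral_Iic_add_Ioi (b := x) hgi.integrableOn hgi.integrableOn
    rw [hg0] at this
    linarith
  have hAd : ∀ x, HasDerivAt A (g x) x := fun x => by
    have h2 : A = fun y => A 0 + ∫ t in (0 : ℝ)..y, g t := by
      ext y
      rw [← intervalIntegral.integral_Iic_sub_Iic hgi.integrableOn hgi.integrableOn]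
      simp only [hA]
      ring
    rw [h2]
    exact (intervalIntegral.integral_hasDerivAt_right (hgc.intervalIntegrable _ _)
      (hgc.stronglyMeasurableAtFilter _ _) hgc.continuousAt).const_add _
  have hAc : Continuous A := continuous_iff_continuousAt.2 fun x => (hAd x).continuousAt
  have hA0 : ∀ x, 0 ≤ A x := fun x => by
    rcases le_total c (h x) with hx | hx
    · refine setIntegral_nonneg measurableSet_Iic fun t ht => mul_nonneg ?_ (hφpos t).le
      have := ha (mem_Iic.1 ht)
      linarith
    · rw [hA', neg_nonneg]
      refine setIntegral_nonpos measurableSet_Ioi fun t ht =>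
        mul_nonpos_of_nonpos_of_nonneg ?_ (hφpos t).le
      have := ha (le_of_lt (mem_Ioi.1 ht))
      linarith
  have hright : ∀ x, 0 ≤ x → x * A x ≤ c * φ x := fun x hx => by
    have h2 : A x ≤ c * ∫ t in Ioi x, φ t := by
      rw [hA', ← integral_neg, ← integral_const_mul]
      refine setIntegral_mono_on hgi.neg.integrableOn (hφi.const_mul c).integrableOn
        measurableSet_Ioi fun t _ => ?_
      simp only [hg]
      nlinarith [h0 t, hφpos t]
    have h3 := mul_integral_Ioi_gaussianPDFReal_le x
    rw [← hφ] at h3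
    nlinarith
  have hleft : ∀ x, x ≤ 0 → -x * A x ≤ (1 - c) * φ x := fun x hx => by
    have h2 : A x ≤ (1 - c) * ∫ t in Iic x, φ t := by
      rw [hA, ← integral_const_mul]
      refine setIntegral_mono_on hgi.integrableOn (hφi.const_mul (1 - c)).integrableOn
        measurableSet_Iic fun t _ => ?_
      simp only [hg]
      nlinarith [h1 t, hφpos t]
    have h3 := neg_mul_integral_Iic_gaussianPDFReal_le x
    rw [← hφ] at h3
    nlinarith
  refine ⟨fun x => A x / φ x, fun x => h x - c + x * (A x / φ x), fun x => ?_, ?_, fun x => ?_,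
    fun x => by ring⟩
  · refine ((hAd x).fun_div (hasDerivAt_gaussianPDFReal_standard x) (hφpos x).ne').congr_deriv ?_
    have := (hφpos x).ne'
    rw [← hφ]
    simp only [hg]
    field_simp
    ring
  · exact ((hc.sub continuous_const).add
      (continuous_id.mul (hAc.div hφc fun x => (hφpos x).ne'))).measurable
  · have hq0 : 0 ≤ A x / φ x := div_nonneg (hA0 x) (hφpos x).le
    rw [abs_le]
    rcases le_total 0 x with hx | hx
    · have h2 : x * (A x / φ x) ≤ c := by
        rw [← mul_div_assoc, div_le_iff₀ (hφpos x)]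
        exact hright x hx
      have h3 : 0 ≤ x * (A x / φ x) := mul_nonneg hx hq0
      constructor <;> linarith [h0 x, h1 x]
    · have h2 : -x * (A x / φ x) ≤ 1 - c := by
        rw [← mul_div_assoc, div_le_iff₀ (hφpos x)]
        exact hleft x hx
      have h3 : 0 ≤ -x * (A x / φ x) := mul_nonneg (by linarith) hq0
      constructor <;> linarith [h0 x, h1 x]

/-- The piecewise linear function equal to `1` on `(-∞, z]` and to `0` on `[z + ε, ∞)`. -/
noncomputable def rampFun (z ε x : ℝ) : ℝ := max 0 (min 1 ((z - x) / ε + 1))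

theorem continuous_rampFun (z ε : ℝ) : Continuous (rampFun z ε) := by
  unfold rampFun; fun_prop

theorem rampFun_nonneg (z ε x : ℝ) : 0 ≤ rampFun z ε x := le_max_left _ _

theorem rampFun_le_one (z ε x : ℝ) : rampFun z ε x ≤ 1 := max_le zero_le_one (min_le_left _ _)

theorem antitone_rampFun (z : ℝ) {ε : ℝ} (hε : 0 < ε) : Antitone (rampFun z ε) := fun x y hxy => by
  unfold rampFun
  gcongr

theorem abs_rampFun_sub_le (z : ℝ) {ε : ℝ} (hε : 0 < ε) (x y : ℝ) :
    |rampFun z ε x - rampFun z ε y| ≤ ε⁻¹ * |x - y| := by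
  have h1 := abs_max_sub_max_le_max 0 (min 1 ((z - x) / ε + 1)) 0 (min 1 ((z - y) / ε + 1))
  have h2 := abs_min_sub_min_le_max 1 ((z - x) / ε + 1) 1 ((z - y) / ε + 1)
  refine ((h1.trans (max_le (by simp) le_rfl)).trans
    (h2.trans (max_le (by simp) le_rfl))).trans_eq ?_
  rw [add_sub_add_right_eq_sub, ← sub_div, sub_sub_sub_cancel_left, abs_div, abs_of_pos hε,
    abs_sub_comm, div_eq_inv_mul]

theorem indicator_Iic_le_rampFun (z : ℝ) {ε : ℝ} (hε : 0 < ε) (x : ℝ) :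
    (Iic z).indicator 1 x ≤ rampFun z ε x := by
  by_cases hx : x ≤ z
  · have : 0 ≤ (z - x) / ε := div_nonneg (by linarith) hε.le
    simp only [mem_Iic, hx, indicator_of_mem, Pi.one_apply, rampFun]
    exact le_max_of_le_right (le_min le_rfl (by linarith))
  · simpa [hx] using rampFun_nonneg z ε x

theorem rampFun_le_indicator_Iic (z : ℝ) {ε : ℝ} (hε : 0 < ε) (x : ℝ) :
    rampFun z ε x ≤ (Iic (z + ε)).indicator 1 x := by
  by_cases hx : x ≤ z + ε
  · simpa [hx] using rampFun_le_one z ε x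
  · have : (z - x) / ε + 1 ≤ 0 := by
      rw [div_add_one hε.ne']
      exact div_nonpos_of_nonpos_of_nonneg (by linarith) hε.le
    simp only [mem_Iic, hx, not_false_eq_true, indicator_of_notMem, rampFun]
    exact max_le le_rfl ((min_le_right _ _).trans this)

theorem integrable_rampFun {μ : Measure ℝ} [IsFiniteMeasure μ] (z ε : ℝ) :
    Integrable (rampFun z ε) μ :=
  Integrable.of_bound (continuous_rampFun z ε).aestronglyMeasurable 1 (ae_of_all _ fun x => by
    rw [Real.norm_eq_abs, abs_of_nonneg (rampFun_nonneg _ _ _)]; exact rampFun_le_one _ _ _)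

theorem measureReal_Iic_le_integral_rampFun {μ : Measure ℝ} [IsFiniteMeasure μ] (z : ℝ) {ε : ℝ}
    (hε : 0 < ε) : μ.real (Iic z) ≤ ∫ x, rampFun z ε x ∂μ := by
  rw [← integral_indicator_one measurableSet_Iic]
  exact integral_mono ((integrable_const 1).indicator measurableSet_Iic) (integrable_rampFun z ε)
    (indicator_Iic_le_rampFun z hε)

theorem integral_rampFun_le_measureReal_Iic {μ : Measure ℝ} [IsFiniteMeasure μ] (z : ℝ) {ε : ℝ}
    (hε : 0 < ε) : ∫ x, rampFun z ε x ∂μ ≤ μ.real (Iic (z + ε)) := by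
  rw [← integral_indicator_one measurableSet_Iic]
  exact integral_mono (integrable_rampFun z ε) ((integrable_const 1).indicator measurableSet_Iic)
    (rampFun_le_indicator_Iic z hε)

theorem gaussianReal_real_Iic_add_le (z : ℝ) {ε : ℝ} (hε : 0 < ε) :
    (gaussianReal 0 1).real (Iic (z + ε)) ≤ (gaussianReal 0 1).real (Iic z) + ε := by
  have hpdf : ∀ x, gaussianPDFReal 0 1 x ≤ 1 := fun x => by
    rw [gaussianPDFReal]
    refine mul_le_one₀ (inv_le_one_of_one_le₀ ?_) (Real.exp_pos _).le (Real.exp_le_one_iff.2 ?_)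
    · rw [Real.one_le_sqrt]
      simp only [NNReal.coe_one]
      linarith [Real.pi_gt_three]
    · exact div_nonpos_of_nonpos_of_nonneg (by nlinarith) (by simp)
  have hle : (gaussianReal 0 1) (Ioc z (z + ε)) ≤ ENNReal.ofReal ε := by
    rw [gaussianReal_apply 0 one_ne_zero]
    calc _ ≤ ∫⁻ _ in Ioc z (z + ε), 1 := lintegral_mono fun x => by
          rw [gaussianPDF, ENNReal.ofReal_le_one]; exact hpdf x
      _ = ENNReal.ofReal ε := by simp
  have h2 : (gaussianReal 0 1).real (Ioc z (z + ε)) ≤ ε := by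
    rw [measureReal_def]
    exact ENNReal.toReal_le_of_le_ofReal hε.le hle
  rw [← Iic_union_Ioc_eq_Iic (by linarith : z ≤ z + ε)]
  exact (measureReal_union_le _ _).trans (by linarith)

theorem kolmogorovDist_gaussianReal_le {μ : Measure ℝ} [IsProbabilityMeasure μ] {K : ℝ}
    (h : ∀ z ε, 0 < ε →
      |∫ x, rampFun z ε x ∂μ - ∫ x, rampFun z ε x ∂gaussianReal 0 1| ≤ K) :
    kolmogorovDist μ (gaussianReal 0 1) ≤ K := by
  refine ciSup_le fun z => ?_
  refine le_of_forall_pos_le_add fun ε hε => ?_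
  rw [abs_le]
  constructor
  · have h1 := (abs_le.1 (h (z - ε) ε hε)).1
    have h2 := integral_rampFun_le_measureReal_Iic (μ := μ) (z - ε) hε
    have h3 := measureReal_Iic_le_integral_rampFun (μ := gaussianReal 0 1) (z - ε) hε
    have h4 := gaussianReal_real_Iic_add_le (z - ε) hε
    rw [sub_add_cancel] at h2 h4
    linarith
  · have h1 := (abs_le.1 (h z ε hε)).2
    have h2 := measureReal_Iic_le_integral_rampFun (μ := μ) z hε
    have h3 := integral_rampFun_le_measureReal_Iic (μ := gaussianReal 0 1) z hε
    have h4 := gaussianReal_real_Iic_add_le z hε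
    linarith

end SteinEquation

section HermitePolynomials

open Polynomial in
theorem derivative_hermite_succ (n : ℕ) :
    derivative (hermite (n + 1)) = ((n + 1 : ℕ) : ℤ[X]) * hermite n := by
  induction n with
  | zero => simp
  | succ n ih =>
    rw [hermite_succ (n + 1), derivative_sub, derivative_mul, derivative_X, one_mul, ih,
      derivative_mul, derivative_natCast, zero_mul, zero_add, hermite_succ n]
    push_cast
    ring

open Polynomial in
theorem hermite_ode (n : ℕ) :
    X * derivative (hermite n) - derivative (derivative (hermite n)) = (n : ℤ[X]) * hermite n := by
  cases n with
  | zero => simp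
  | succ n =>
    rw [derivative_hermite_succ, derivative_mul, derivative_natCast, zero_mul, zero_add,
      hermite_succ]
    ring

open MvPolynomial

/-- The linear form with coefficients `c`. -/
noncomputable def linearForm {n : ℕ} (c : Fin n → ℝ) : MvPolynomial (Fin n) ℝ :=
  ∑ i, C (c i) * X i

theorem eval_linearForm {n : ℕ} (c x : Fin n → ℝ) : eval x (linearForm c) = ∑ i, c i * x i := by
  simp [linearForm]

theorem isHomogeneous_linearForm {n : ℕ} (c : Fin n → ℝ) : (linearForm c).IsHomogeneous 1 :=
  IsHomogeneous.sum _ _ _ fun _ _ => isHomogeneous_C_mul_X _ _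

theorem pderiv_linearForm {n : ℕ} (c : Fin n → ℝ) (i : Fin n) :
    pderiv i (linearForm c) = C (c i) := by
  simp [linearForm, pderiv_X, Pi.single_apply]

theorem numberOp_aeval_linearForm {n : ℕ} {c : Fin n → ℝ} (hc : ∑ i, c i * c i = 1)
    (p : Polynomial ℝ) :
    numberOp (Polynomial.aeval (linearForm c) p) = Polynomial.aeval (linearForm c)
      (Polynomial.X * p.derivative - p.derivative.derivative) := by
  have h1 : ∀ i (p : Polynomial ℝ), pderiv i (Polynomial.aeval (linearForm c) p)
      = Polynomial.aeval (linearForm c) p.derivative * C (c i) := fun i p => by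
    rw [Derivation.map_aeval, pderiv_linearForm, smul_eq_mul]
  have h2 : ∀ i : Fin n, X i * pderiv i (Polynomial.aeval (linearForm c) p)
      - pderiv i (pderiv i (Polynomial.aeval (linearForm c) p))
      = Polynomial.aeval (linearForm c) p.derivative * (C (c i) * X i)
        - Polynomial.aeval (linearForm c) p.derivative.derivative * C (c i * c i) := fun i => by
    rw [h1, pderiv_mul, h1, pderiv_C, C_mul]
    ring
  rw [numberOp_apply, Finset.sum_congr rfl fun i _ => h2 i, Finset.sum_sub_distrib,
    ← Finset.mul_sum, ← Finset.mul_sum, ← map_sum, hc, C_1, mul_one, ← linearForm, map_sub,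
    map_mul, Polynomial.aeval_X, mul_comm]

/-- The Hermite polynomial `H_q` evaluated at a linear form. -/
noncomputable def hermiteForm {n : ℕ} (q : ℕ) (c : Fin n → ℝ) : MvPolynomial (Fin n) ℝ :=
  Polynomial.aeval (linearForm c) ((Polynomial.hermite q).map (Int.castRingHom ℝ))

theorem numberOp_hermiteForm {n : ℕ} (q : ℕ) {c : Fin n → ℝ} (hc : ∑ i, c i * c i = 1) :
    numberOp (hermiteForm q c) = (q : ℝ) • hermiteForm q c := by
  have h := congrArg (Polynomial.map (Int.castRingHom ℝ)) (hermite_ode q)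
  simp only [Polynomial.map_sub, Polynomial.map_mul, Polynomial.map_X, ← Polynomial.derivative_map,
    Polynomial.map_natCast] at h
  rw [hermiteForm, numberOp_aeval_linearForm hc, h, map_mul, map_natCast, smul_eq_C_mul,
    map_natCast]

theorem hermiteForm_mem_parityDegreeLE {n : ℕ} (q : ℕ) (c : Fin n → ℝ) :
    hermiteForm q c ∈ parityDegreeLE (Fin n) q := by
  rw [hermiteForm, Polynomial.aeval_eq_sum_range' (n := q + 1)]
  · refine sum_mem fun k hk => ?_
    rw [Polynomial.coeff_map]
    rcases Nat.even_or_odd (q + k) with h | h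
    · obtain ⟨m, hm⟩ := h
      have hkq := Finset.mem_range.1 hk
      have hq : q = k + 2 * (m - k) := by omega
      refine Submodule.smul_mem _ _ ?_
      conv => enter [1, 2]; rw [hq]
      refine isHomogeneous_mem_parityDegreeLE ?_
      simpa using (isHomogeneous_linearForm c).pow k
    · rw [Polynomial.coeff_hermite_of_odd_add h]
      simp
  · exact Nat.lt_succ_of_le ((Polynomial.natDegree_map_le).trans Polynomial.natDegree_hermite.le)

theorem eval_hermiteForm {n : ℕ} (q : ℕ) (c x : Fin n → ℝ) :
    eval x (hermiteForm q c) = Polynomial.aeval (∑ i, c i * x i) (Polynomial.hermite q) := by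
  have h : eval x (hermiteForm q c) = Polynomial.aeval (aeval x (linearForm c))
      ((Polynomial.hermite q).map (Int.castRingHom ℝ)) :=
    (Polynomial.aeval_algHom_apply (aeval x : MvPolynomial (Fin n) ℝ →ₐ[ℝ] ℝ) _ _).symm
  rw [h, Polynomial.aeval_def, Polynomial.eval₂_map, Polynomial.aeval_def, aeval_eq_eval,
    eval_linearForm]
  congr 1

end HermitePolynomials

section IsonormalProcess

variable {Ω H : Type*} [MeasurableSpace Ω] {P : Measure Ω} [NormedAddCommGroup H]
  [InnerProductSpace ℝ H] {X : H → Ω → ℝ}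

namespace IsIsonormalProcess

theorem memLp_two (hX : IsIsonormalProcess X P) (h : H) : MemLp (X h) 2 P :=
  (hX.isGaussianProcess.hasGaussianLaw_eval h).memLp_two

theorem integrable_mul (hX : IsIsonormalProcess X P) (g h : H) :
    Integrable (fun ω => X g ω * X h ω) P :=
  (hX.memLp_two g).integrable_mul (hX.memLp_two h)

theorem ae_eq_sum (hX : IsIsonormalProcess X P) {n : ℕ} {h : H} {c : Fin n → ℝ} {e : Fin n → H}
    (he : h = ∑ j, c j • e j) : X h =ᵐ[P] fun ω => ∑ j, c j * X (e j) ω := by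
  set D : Ω → ℝ := fun ω => X h ω - ∑ j, c j * X (e j) ω with hD
  have hDL : MemLp D 2 P := (hX.memLp_two h).sub
    (memLp_finsetSum _ fun j _ => (hX.memLp_two (e j)).const_mul (c j))
  have h1 : ∀ g, ∫ ω, D ω * X g ω ∂P = 0 := fun g => by
    have : ∀ ω, D ω * X g ω = X h ω * X g ω - ∑ j, c j * (X (e j) ω * X g ω) := fun ω => by
      simp only [hD, sub_mul, Finset.sum_mul, mul_assoc]
    simp_rw [this]
    rw [integral_sub (hX.integrable_mul h g)
      (integrable_finsetSum _ fun j _ => (hX.integrable_mul _ _).const_mul _),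
      integral_finsetSum _ fun j _ => (hX.integrable_mul _ _).const_mul _]
    simp_rw [integral_const_mul, hX.covariance]
    rw [he, sum_inner]
    simp [inner_smul_left]
  have h2 : ∫ ω, D ω ^ 2 ∂P = 0 := by
    have : ∀ ω, D ω ^ 2 = D ω * X h ω - ∑ j, c j * (D ω * X (e j) ω) := fun ω => by
      rw [sq]
      nth_rewrite 2 [hD]
      simp only [mul_sub, Finset.mul_sum]
      congr 1
      exact Finset.sum_congr rfl fun j _ => by ring
    have hi : ∀ g, Integrable (fun ω => D ω * X g ω) P := fun g =>
      hDL.integrable_mul (hX.memLp_two g)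
    simp_rw [this]
    rw [integral_sub (hi h) (integrable_finsetSum _ fun j _ => (hi _).const_mul _),
      integral_finsetSum _ fun j _ => (hi _).const_mul _]
    simp_rw [integral_const_mul, h1]
    simp
  rw [integral_eq_zero_iff_of_nonneg (fun ω => sq_nonneg _) hDL.integrable_sq] at h2
  filter_upwards [h2] with ω hω
  exact sub_eq_zero.1 (pow_eq_zero_iff two_ne_zero |>.1 hω)

theorem map_orthonormal (hX : IsIsonormalProcess X P) {n : ℕ} {e : Fin n → H}
    (he : Orthonormal ℝ e) : P.map (fun ω j => X (e j) ω) = stdGaussianPi n := by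
  classical
  have := hX.isGaussianProcess.isProbabilityMeasure
  have hlaw : HasGaussianLaw (fun ω j => X (e j) ω) P :=
    ((hX.isGaussianProcess.comp_right e).hasGaussianLaw Finset.univ).map_fun
      (ContinuousLinearMap.pi fun j => ContinuousLinearMap.proj (R := ℝ)
        (φ := fun _ : (Finset.univ : Finset (Fin n)) => ℝ) ⟨j, Finset.mem_univ j⟩)
  have hcov : ∀ i j, i ≠ j → cov[X (e i), X (e j); P] = 0 := fun i j hij => by
    rw [covariance_eq_sub (hX.memLp_two _) (hX.memLp_two _), hX.centered, hX.centered]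
    simp only [Pi.mul_apply]
    rw [hX.covariance, he.inner_eq_zero hij]
    simp
  have hind := hlaw.iIndepFun_of_covariance_eq_zero hcov
  rw [iIndepFun_iff_map_fun_eq_pi_map fun j => hX.isGaussianProcess.aemeasurable (e j)] at hind
  rw [hind]
  congr 1
  ext1 j
  have hv : Var[X (e j); P] = 1 := by
    rw [variance_eq_sub (hX.memLp_two _), hX.centered]
    simp only [Pi.pow_apply, sq]
    rw [hX.covariance, real_inner_self_eq_norm_sq, he.norm_eq_one]
    simp
  rw [(hX.isGaussianProcess.hasGaussianLaw_eval (e j)).map_eq_gaussianReal, hX.centered, hv,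
    Real.toNNReal_one]

/-- A linear combination of Hermite polynomials of the process is an eigenpolynomial of the number
operator in finitely many independent standard Gaussian variables. -/
theorem exists_polynomial_repr (hX : IsIsonormalProcess X P) {q : ℕ} {F : Lp ℝ 2 P}
    (hF : F ∈ Submodule.span ℝ {F : Lp ℝ 2 P | ∃ h : H, ‖h‖ = 1 ∧
      F =ᵐ[P] fun ω => Polynomial.aeval (X h ω) (Polynomial.hermite q)}) :
    ∃ (n : ℕ) (Y : Ω → Fin n → ℝ) (p : MvPolynomial (Fin n) ℝ), AEMeasurable Y P ∧
      P.map Y = stdGaussianPi n ∧ p ∈ parityDegreeLE (Fin n) q ∧ numberOp p = (q : ℝ) • p ∧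
      F =ᵐ[P] fun ω => MvPolynomial.eval (Y ω) p := by
  obtain ⟨m, a, g, rfl⟩ := Submodule.mem_span_set'.1 hF
  choose h hnorm hae using fun i => (g i).2
  set V := Submodule.span ℝ (Set.range h)
  have : FiniteDimensional ℝ V := FiniteDimensional.span_of_finite ℝ (Set.finite_range h)
  set b := stdOrthonormalBasis ℝ V
  set n := Module.finrank ℝ V
  set v : Fin m → V := fun i => ⟨h i, Submodule.subset_span (Set.mem_range_self i)⟩ with hv
  set c : Fin m → Fin n → ℝ := fun i j => inner ℝ (b j) (v i) with hc
  set e : Fin n → H := fun j => (b j : H) with he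
  have hon : Orthonormal ℝ e := b.orthonormal.comp_linearIsometry V.subtypeₗᵢ
  have hsum : ∀ i, h i = ∑ j, c i j • e j := fun i => by
    have := congrArg (fun x : V => (x : H)) (b.sum_repr' (v i))
    simpa [hv, hc, he] using this.symm
  have hsq : ∀ i, ∑ j, c i j * c i j = 1 := fun i => by
    have := b.sum_inner_mul_inner (v i) (v i)
    rw [real_inner_self_eq_norm_sq, show ‖v i‖ = 1 from hnorm i, one_pow] at this
    rw [← this]
    exact Finset.sum_congr rfl fun j _ => by rw [hc, real_inner_comm (b j)]
  refine ⟨n, fun ω j => X (e j) ω, ∑ i, a i • hermiteForm q (c i),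
    aemeasurable_pi_lambda _ fun j => hX.isGaussianProcess.aemeasurable (e j),
    hX.map_orthonormal hon,
    sum_mem fun i _ => Submodule.smul_mem _ _ (hermiteForm_mem_parityDegreeLE q _), ?_, ?_⟩
  · rw [map_sum, Finset.smul_sum]
    exact Finset.sum_congr rfl fun i _ => by
      rw [map_smul, numberOp_hermiteForm q (hsq i), smul_comm]
  · have h1 : ∀ᵐ ω ∂P, ∀ i, (g i : Lp ℝ 2 P) ω
        = Polynomial.aeval (∑ j, c i j * X (e j) ω) (Polynomial.hermite q) := by
      rw [ae_all_iff]
      intro i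
      filter_upwards [hae i, hX.ae_eq_sum (hsum i)] with ω h1 h2
      rw [h1, h2]
    have h2 : ∀ᵐ ω ∂P, ∀ i, (a i • (g i : Lp ℝ 2 P) : Lp ℝ 2 P) ω = a i * (g i : Lp ℝ 2 P) ω := by
      rw [ae_all_iff]
      exact fun i => Lp.coeFn_smul _ _
    filter_upwards [h1, h2, Lp.coeFn_finsetSum Finset.univ fun i => a i • (g i : Lp ℝ 2 P)]
      with ω h1 h2 h3
    rw [h3, map_sum, Finset.sum_apply]
    refine Finset.sum_congr rfl fun i _ => ?_
    rw [h2, h1, MvPolynomial.smul_eval, eval_hermiteForm]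

end IsIsonormalProcess

end IsonormalProcess

section LpNorms

variable {α : Type*} [MeasurableSpace α] {μ : Measure α}

theorem toReal_eLpNorm_pow {f : α → ℝ} {k : ℕ} (hk : k ≠ 0) (hf : MemLp f k μ) :
    (eLpNorm f k μ).toReal ^ k = ∫ x, |f x| ^ k ∂μ := by
  have hnn : 0 ≤ ∫ x, |f x| ^ k ∂μ := integral_nonneg fun x => by positivity
  rw [hf.eLpNorm_eq_integral_rpow_norm (by exact_mod_cast hk) (ENNReal.natCast_ne_top k)]
  simp only [ENNReal.toReal_natCast, Real.rpow_natCast, Real.norm_eq_abs]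
  rw [ENNReal.toReal_ofReal (by positivity), Real.rpow_inv_natCast_pow hnn hk]

theorem toReal_eLpNorm_two_sq {f : α → ℝ} (hf : MemLp f 2 μ) :
    (eLpNorm f 2 μ).toReal ^ 2 = ∫ x, f x ^ 2 ∂μ := by
  have := toReal_eLpNorm_pow two_ne_zero (by exact_mod_cast hf)
  simpa using this

theorem toReal_eLpNorm_four_pow {f : α → ℝ} (hf : MemLp f 4 μ) :
    (eLpNorm f 4 μ).toReal ^ 4 = ∫ x, f x ^ 4 ∂μ := by
  have := toReal_eLpNorm_pow (k := 4) (by norm_num) (by exact_mod_cast hf)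
  simpa [Even.pow_abs (by decide : Even 4)] using this

theorem norm_sq_eq_integral (F : Lp ℝ 2 μ) : ‖F‖ ^ 2 = ∫ x, F x ^ 2 ∂μ := by
  rw [Lp.norm_def, toReal_eLpNorm_two_sq (Lp.memLp F)]

end LpNorms

section WienerChaos

open Filter Topology

variable {Ω H : Type*} [MeasurableSpace Ω] {P : Measure Ω} [NormedAddCommGroup H]

/-- Finite linear combinations of the `H_q(X(h))` with `‖h‖ = 1`. -/
def hermiteSpan (X : H → Ω → ℝ) (P : Measure Ω) (q : ℕ) : Submodule ℝ (Lp ℝ 2 P) :=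
  Submodule.span ℝ {F : Lp ℝ 2 P | ∃ h : H, ‖h‖ = 1 ∧
    F =ᵐ[P] fun ω => Polynomial.aeval (X h ω) (Polynomial.hermite q)}

variable [InnerProductSpace ℝ H] {X : H → Ω → ℝ}

namespace IsIsonormalProcess

theorem exists_moments_eq (hX : IsIsonormalProcess X P) {q : ℕ} {F : Lp ℝ 2 P}
    (hF : F ∈ hermiteSpan X P q) :
    ∃ (n : ℕ) (p : MvPolynomial (Fin n) ℝ), p ∈ parityDegreeLE (Fin n) q ∧
      numberOp p = (q : ℝ) • p ∧
      ∀ g : ℝ → ℝ, Measurable g →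
        (Integrable (fun ω => g (F ω)) P ↔
          Integrable (fun x => g (MvPolynomial.eval x p)) (stdGaussianPi n)) ∧
        ∫ ω, g (F ω) ∂P = ∫ x, g (MvPolynomial.eval x p) ∂stdGaussianPi n := by
  obtain ⟨n, Y, p, hY, hmap, hp, hN, hae⟩ := hX.exists_polynomial_repr hF
  refine ⟨n, p, hp, hN, fun g hg => ?_⟩
  have hm : AEStronglyMeasurable (fun x => g (MvPolynomial.eval x p)) (P.map Y) :=
    (hg.comp (MvPolynomial.continuous_eval p).measurable).aestronglyMeasurable
  have hae' : (fun ω => g (F ω)) =ᵐ[P] (fun x => g (MvPolynomial.eval x p)) ∘ Y := by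
    filter_upwards [hae] with ω hω
    simp [hω]
  rw [integrable_congr hae', integral_congr_ae hae', ← hmap]
  exact ⟨(integrable_map_measure hm hY).symm, (integral_map hY hm).symm⟩

theorem moments_of_mem_hermiteSpan (hX : IsIsonormalProcess X P) {q : ℕ} (hq : 1 ≤ q)
    {F : Lp ℝ 2 P} (hF : F ∈ hermiteSpan X P q) :
    MemLp F 4 P ∧ ∫ ω, F ω ^ 4 ∂P ≤ 9 ^ q * (∫ ω, F ω ^ 2 ∂P) ^ 2 ∧
      3 * (∫ ω, F ω ^ 2 ∂P) ^ 2 ≤ ∫ ω, F ω ^ 4 ∂P ∧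
      ∀ h : ℝ → ℝ, Continuous h → Antitone h → (∀ x, 0 ≤ h x) → (∀ x, h x ≤ 1) →
        |∫ ω, h (F ω) ∂P - ∫ x, h x ∂gaussianReal 0 1| ≤ |1 - ∫ ω, F ω ^ 2 ∂P| +
          √((q - 1) / (3 * q) * (∫ ω, F ω ^ 4 ∂P - 3 * (∫ ω, F ω ^ 2 ∂P) ^ 2)) := by
  obtain ⟨n, p, hp, hN, hg⟩ := hX.exists_moments_eq hF
  have hE := isGaussianFunctional_gaussianExpectation n
  have hpow : ∀ k : ℕ, ∫ ω, F ω ^ k ∂P = gaussianExpectation n (p ^ k) := fun k => by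
    rw [gaussianExpectation_apply, (hg (fun y => y ^ k) (by fun_prop)).2]
    simp only [map_pow]
  refine ⟨?_, ?_, ?_, fun h hc ha h0 h1 => ?_⟩
  · rw [← integrable_norm_rpow_iff (Lp.aestronglyMeasurable F) (by norm_num) (by norm_num)]
    simp only [ENNReal.toReal_ofNat, Real.rpow_ofNat]
    refine (hg (fun y => ‖y‖ ^ 4) (by fun_prop)).1.2 ?_
    exact (integrable_eval_stdGaussianPi (p ^ 4)).congr
      (ae_of_all _ fun x => by simp [Even.pow_abs (by decide : Even 4)])
  · rw [hpow, hpow]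
    exact hE.map_pow_four_le hp hN
  · rw [hpow, hpow]
    exact (hE.fourth_moment hq hp hN).1
  · obtain ⟨f, f', hf, hf'm, hf', heq⟩ := exists_stein_solution hc ha h0 h1
    have := abs_integral_stein_le hq hp hN hf hf'm hf'
    simp_rw [heq] at this
    rw [integral_sub _ (integrable_const _), integral_const, probReal_univ, one_smul] at this
    · rw [hpow, hpow, (hg h hc.measurable).2]
      exact this
    · exact Integrable.of_bound
        (hc.measurable.comp (MvPolynomial.continuous_eval p).measurable).aestronglyMeasurable 1
        (ae_of_all _ fun x => by rw [Real.norm_eq_abs, abs_of_nonneg (h0 _)]; exact h1 _)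

theorem eLpNorm_four_le_of_mem_hermiteSpan (hX : IsIsonormalProcess X P) {q : ℕ} (hq : 1 ≤ q)
    {F : Lp ℝ 2 P} (hF : F ∈ hermiteSpan X P q) : eLpNorm F 4 P ≤ 3 ^ q * eLpNorm F 2 P := by
  obtain ⟨h4, hle, -⟩ := hX.moments_of_mem_hermiteSpan hq hF
  rw [← toReal_eLpNorm_four_pow h4, ← toReal_eLpNorm_two_sq (Lp.memLp F)] at hle
  have h2 : eLpNorm F 2 P ≠ ⊤ := (Lp.memLp F).eLpNorm_ne_top
  rw [← ENNReal.toReal_le_toReal h4.eLpNorm_ne_top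
    (ENNReal.mul_ne_top (ENNReal.pow_ne_top (by norm_num)) h2), ENNReal.toReal_mul,
    ENNReal.toReal_pow, ENNReal.toReal_ofNat]
  set a := (eLpNorm F 2 P).toReal
  refine le_of_pow_le_pow_left₀ four_ne_zero (by positivity) (hle.trans ?_)
  have : (9 : ℝ) ^ q ≤ (3 ^ q) ^ 4 := by
    rw [← pow_mul, mul_comm, pow_mul]
    exact pow_le_pow_left₀ (by norm_num) (by norm_num) q
  rw [mul_pow, ← pow_mul]
  gcongr

/-- Equivalence of the `L⁴` and `L²` norms on a Wiener chaos. -/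
theorem eLpNorm_four_le (hX : IsIsonormalProcess X P) {q : ℕ} (hq : 1 ≤ q)
    {G : Lp ℝ 2 P} (hG : G ∈ wienerChaos X P q) : eLpNorm G 4 P ≤ 3 ^ q * eLpNorm G 2 P := by
  obtain ⟨F, hF, hlim⟩ := mem_closure_iff_seq_limit.1 hG
  obtain ⟨ns, hns, hae⟩ := (tendstoInMeasure_of_tendsto_eLpNorm two_ne_zero
    (fun n => Lp.aestronglyMeasurable (F n)) (Lp.aestronglyMeasurable G)
    ((Lp.tendsto_Lp_iff_tendsto_eLpNorm' F G).1 hlim)).exists_seq_tendsto_ae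
  have hlim' : Tendsto (fun k => 3 ^ q * eLpNorm (F (ns k)) 2 P) atTop
      (𝓝 (3 ^ q * eLpNorm G 2 P)) := by
    refine ENNReal.Tendsto.const_mul ?_ (Or.inr (ENNReal.pow_ne_top (by norm_num)))
    simp_rw [← Lp.enorm_def]
    exact (continuous_enorm.tendsto G).comp (hlim.comp hns.tendsto_atTop)
  rw [← hlim'.liminf_eq]
  exact (Lp.eLpNorm_lim_le_liminf_eLpNorm (fun k => Lp.aestronglyMeasurable (F (ns k))) G hae).trans
    (liminf_le_liminf (Eventually.of_forall fun k =>
      hX.eLpNorm_four_le_of_mem_hermiteSpan hq (hF _)))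

theorem memLp_four (hX : IsIsonormalProcess X P) {q : ℕ} (hq : 1 ≤ q)
    {G : Lp ℝ 2 P} (hG : G ∈ wienerChaos X P q) : MemLp G 4 P :=
  ⟨Lp.aestronglyMeasurable G, (hX.eLpNorm_four_le hq hG).trans_lt
    (ENNReal.mul_lt_top (ENNReal.pow_lt_top (by norm_num)) (Lp.eLpNorm_lt_top G))⟩

theorem tendsto_integral_pow_four (hX : IsIsonormalProcess X P) {q : ℕ} (hq : 1 ≤ q)
    {F : ℕ → Lp ℝ 2 P} {G : Lp ℝ 2 P} (hF : ∀ n, F n ∈ wienerChaos X P q)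
    (hG : G ∈ wienerChaos X P q) (hlim : Tendsto F atTop (𝓝 G)) :
    Tendsto (fun n => ∫ ω, F n ω ^ 4 ∂P) atTop (𝓝 (∫ ω, G ω ^ 4 ∂P)) := by
  have h4 : Fact ((1 : ENNReal) ≤ 4) := ⟨by norm_num⟩
  have hle : ∀ n, eLpNorm (⇑(F n) - ⇑G) 4 P ≤ 3 ^ q * eLpNorm (⇑(F n) - ⇑G) 2 P := fun n => by
    have := hX.eLpNorm_four_le hq (sub_mem (hF n) hG)
    rwa [eLpNorm_congr_ae (Lp.coeFn_sub (F n) G), eLpNorm_congr_ae (Lp.coeFn_sub (F n) G)] at this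
  have h0 : Tendsto (fun n => 3 ^ q * eLpNorm (⇑(F n) - ⇑G) 2 P) atTop (𝓝 0) := by
    rw [← mul_zero ((3 : ENNReal) ^ q)]
    exact ENNReal.Tendsto.const_mul ((Lp.tendsto_Lp_iff_tendsto_eLpNorm' F G).1 hlim)
      (Or.inr (ENNReal.pow_ne_top (by norm_num)))
  have h1 := (Lp.tendsto_Lp_iff_tendsto_eLpNorm'' (fun n => ⇑(F n))
    (fun n => hX.memLp_four hq (hF n)) G (hX.memLp_four hq hG)).2
    (tendsto_of_tendsto_of_tendsto_of_le_of_le tendsto_const_nhds h0 (fun _ => zero_le) hle)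
  have h2 := (h1.norm).pow 4
  simp only [Lp.norm_toLp] at h2
  simp_rw [fun n => toReal_eLpNorm_four_pow (hX.memLp_four hq (hF n)),
    toReal_eLpNorm_four_pow (hX.memLp_four hq hG)] at h2
  exact h2

theorem tendsto_integral_lipschitz [IsProbabilityMeasure P] {F : ℕ → Lp ℝ 2 P} {G : Lp ℝ 2 P}
    (hlim : Tendsto F atTop (𝓝 G)) {h : ℝ → ℝ} {C : ℝ} (hc : Continuous h)
    (hb : ∀ x, |h x| ≤ 1) (hL : ∀ x y, |h x - h y| ≤ C * |x - y|) :
    Tendsto (fun n => ∫ ω, h (F n ω) ∂P) atTop (𝓝 (∫ ω, h (G ω) ∂P)) := by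
  have hi : ∀ F : Lp ℝ 2 P, Integrable (fun ω => h (F ω)) P := fun F =>
    Integrable.of_bound (hc.comp_aestronglyMeasurable (Lp.aestronglyMeasurable F)) 1
      (ae_of_all _ fun ω => hb _)
  have hle : ∀ n, ‖∫ ω, h (F n ω) ∂P - ∫ ω, h (G ω) ∂P‖ ≤ |C| * ‖F n - G‖ := fun n => by
    have hD := Lp.memLp (F n - G)
    have h1 : ∫ ω, |(F n - G : Lp ℝ 2 P) ω| ∂P ≤ ‖F n - G‖ := by
      refine (integral_abs_le_sqrt hD).trans_eq ?_
      rw [← norm_sq_eq_integral, Real.sqrt_sq (norm_nonneg _)]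
    rw [← integral_sub (hi _) (hi _)]
    refine (norm_integral_le_of_norm_le (g := fun ω => |C| * |(F n - G : Lp ℝ 2 P) ω|)
      (((hD.integrable one_le_two).abs).const_mul _) ?_).trans ?_
    · filter_upwards [Lp.coeFn_sub (F n) G] with ω hω
      rw [hω]
      exact (hL _ _).trans (mul_le_mul_of_nonneg_right (le_abs_self C) (abs_nonneg _))
    · rw [integral_const_mul]
      gcongr
  refine tendsto_iff_norm_sub_tendsto_zero.2 (squeeze_zero (fun _ => norm_nonneg _) hle ?_)
  rw [← mul_zero |C|]
  exact (tendsto_iff_norm_sub_tendsto_zero.1 hlim).const_mul _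

end IsIsonormalProcess

end WienerChaos

theorem theorem3p3 {Ω H : Type*} [MeasurableSpace Ω] (P : Measure Ω) [IsProbabilityMeasure P]
    [NormedAddCommGroup H] [InnerProductSpace ℝ H] [CompleteSpace H]
    [TopologicalSpace.SeparableSpace H]
    (X : H → Ω → ℝ) (hX : IsIsonormalProcess X P)
    (q : ℕ) (hq : 2 ≤ q)
    (Z : Ω → ℝ) (hZ : MemLp Z 2 P) (hZq : hZ.toLp Z ∈ wienerChaos X P q)
    (hvar : ∫ ω, Z ω ^ 2 ∂P = 1) :
    Integrable (fun ω => Z ω ^ 4) P ∧ 3 ≤ ∫ ω, Z ω ^ 4 ∂P ∧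
      kolmogorovDist (P.map Z) (gaussianReal 0 1) ≤
        √(((q : ℝ) - 1) / (3 * (q : ℝ)) * ((∫ ω, Z ω ^ 4 ∂P) - 3)) := by
  have hq1 : 1 ≤ q := by omega
  set G := hZ.toLp Z with hG
  have hGZ : G =ᵐ[P] Z := hZ.coeFn_toLp
  have hZ4 : MemLp Z 4 P := (memLp_congr_ae hGZ).1 (hX.memLp_four hq1 hZq)
  obtain ⟨F, hF, hlim⟩ := mem_closure_iff_seq_limit.1 hZq
  have hFc : ∀ n, F n ∈ wienerChaos X P q := fun n => Submodule.le_topologicalClosure _ (hF n)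
  have hG4 : ∫ ω, G ω ^ 4 ∂P = ∫ ω, Z ω ^ 4 ∂P :=
    integral_congr_ae (hGZ.mono fun ω hω => by simp only [hω])
  have hG2 : ∫ ω, G ω ^ 2 ∂P = 1 := by
    rw [← hvar]
    exact integral_congr_ae (hGZ.mono fun ω hω => by simp only [hω])
  have hlim4 := hX.tendsto_integral_pow_four hq1 hFc hZq hlim
  rw [hG4] at hlim4
  have hlim2 : Filter.Tendsto (fun n => ∫ ω, F n ω ^ 2 ∂P) Filter.atTop (nhds 1) := by
    have := (hlim.norm).pow 2
    simp_rw [norm_sq_eq_integral, hG2] at this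
    exact this
  refine ⟨?_, ?_, ?_⟩
  · exact (hZ4.integrable_norm_pow (by norm_num)).congr
      (ae_of_all _ fun ω => by simp [Even.pow_abs (by decide : Even 4)])
  · have := le_of_tendsto_of_tendsto' ((hlim2.pow 2).const_mul 3) hlim4
      fun n => (hX.moments_of_mem_hermiteSpan hq1 (hF n)).2.2.1
    simpa using this
  · have hprob : IsProbabilityMeasure (P.map Z) :=
      Measure.isProbabilityMeasure_map hZ.aestronglyMeasurable.aemeasurable
    refine kolmogorovDist_gaussianReal_le fun z ε hε => ?_
    have hc := continuous_rampFun z ε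
    rw [integral_map hZ.aestronglyMeasurable.aemeasurable hc.aestronglyMeasurable,
      ← integral_congr_ae (hGZ.mono fun ω hω => by simp only [hω] :
        (fun ω => rampFun z ε (G ω)) =ᵐ[P] fun ω => rampFun z ε (Z ω))]
    have hl := IsIsonormalProcess.tendsto_integral_lipschitz hlim hc
      (fun x => by rw [abs_of_nonneg (rampFun_nonneg _ _ _)]; exact rampFun_le_one _ _ _)
      (abs_rampFun_sub_le z hε)
    have hr : Filter.Tendsto (fun n => |1 - ∫ ω, F n ω ^ 2 ∂P| +
        √((q - 1) / (3 * q) * (∫ ω, F n ω ^ 4 ∂P - 3 * (∫ ω, F n ω ^ 2 ∂P) ^ 2))) Filter.atTop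
        (nhds (|1 - (1 : ℝ)| + √((q - 1) / (3 * q) * (∫ ω, Z ω ^ 4 ∂P - 3 * 1 ^ 2)))) :=
      ((hlim2.const_sub 1).abs).add
        ((hlim4.sub ((hlim2.pow 2).const_mul 3)).const_mul _).sqrt
    rw [sub_self, abs_zero, zero_add, one_pow, mul_one] at hr
    exact le_of_tendsto_of_tendsto' ((hl.sub_const _).abs) hr fun n =>
      (hX.moments_of_mem_hermiteSpan hq1 (hF n)).2.2.2 _ hc (antitone_rampFun z hε)
        (rampFun_nonneg z ε) (rampFun_le_one z ε)
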